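/- There is an absolute constant $C>0$ such that the following holds. Let $K\ge 1$, $p_1,\dots,p_K\ge 1$, $p=\sum_{k=1}^K p_k$, and let $n\ge p_k$ for all $k$. Let $\Sigma\in\mathbb{R}^{p\times p}$ be symmetric positive definite, and let $A\in\mathbb{R}^{n\times p}$ be a random matrix whose rows are i.i.d. $\mathcal{N}(0,\Sigma)$. Partition $A=[A_1,\dots,A_K]$ into column blocks $A_k\in\mathbb{R}^{n\times p_k}$, let $\Sigma_k\in\mathbb{R}^{p_k\times p_k}$ be the corresponding $k$-th diagonal block (principal submatrix) of $\Sigma$, let $\bar A=[A_1^+;\dots;A_K^+]\in\mathbb{R}^{p\times n}$ be obtained by stacking the Moore–Penrose pseudoinverses of the blocks vertically, and let $$B=I_p-\tfrac1K\bar A A .$$ Let $q_1,\dots,q_K\ge 0$ and define $$\ell_k(q_k)=\tfrac83\,n\,\sigma_{\max}(\Sigma_k)\,C\left(\sqrt{\tfrac{p_k+q_k}{n}}+\tfrac{p_k+q_k}{n}\right),\qquad \bar\gamma_{k,i}=\frac{n\sigma_{\max}(\Sigma_k)+\ell_k(q_k)}{\bigl(n\sigma_{\min}(\Sigma_i)-\ell_i(q_i)\bigr)_+},$$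 where $\sigma_{\max},\sigma_{\min}$ denote the largest and smallest singular values, $(x)_+=\max\{0,x\}$, and $\bar\gamma_{k,i}=+\infty$ if the denominator is $0$. Then, with probability at least $1-2\sum_{k=1}^K e^{-q_k}$, the spectral norm of $B$ satisfies $$\|B\|\le\bar\beta_G:=\sqrt{\frac{(K-1)^2}{K}+\frac1{K^2}\sum_{k=1}^K\sum_{\substack{i=1\\ i\ne k}}^K\bar\gamma_{k,i}}\,.$$ -/

import Mathlib

open MeasureTheory ProbabilityTheory
open scoped ENNReal Matrix

namespace Cocoa

section PseudoInverse

variable {m n : Type*} [Fintype m] [Fintype n]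

/-- The four Penrose equations: `X` is a Moore-Penrose pseudoinverse of the real matrix `M`. -/
structure IsMoorePenrose (M : Matrix m n ℝ) (X : Matrix n m ℝ) : Prop where
  mul_mul_self : M * X * M = M
  self_mul_mul : X * M * X = X
  transpose_left : (M * X)ᵀ = M * X
  transpose_right : (X * M)ᵀ = X * M

theorem IsMoorePenrose.unique {M : Matrix m n ℝ} {X Y : Matrix n m ℝ}
    (hX : IsMoorePenrose M X) (hY : IsMoorePenrose M Y) : X = Y := by
  have h1 : M * X = M * Y := by
    calc M * X = (M * X)ᵀ := hX.transpose_left.symm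
      _ = ((M * Y) * (M * X))ᵀ := by
          rw [← Matrix.mul_assoc, hY.mul_mul_self]
      _ = (M * X) * (M * Y) := by
          rw [Matrix.transpose_mul, hX.transpose_left, hY.transpose_left]
      _ = M * Y := by rw [← Matrix.mul_assoc, hX.mul_mul_self]
  have h2 : X * M = Y * M := by
    calc X * M = (X * M)ᵀ := hX.transpose_right.symm
      _ = ((X * M) * (Y * M))ᵀ := by
          rw [Matrix.mul_assoc, ← Matrix.mul_assoc M, hY.mul_mul_self]
      _ = (Y * M) * (X * M) := by
          rw [Matrix.transpose_mul, hX.transpose_right, hY.transpose_right]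
      _ = Y * M := by rw [Matrix.mul_assoc, ← Matrix.mul_assoc M, hX.mul_mul_self]
  calc X = X * M * X := hX.self_mul_mul.symm
    _ = Y * M * Y := by rw [h2, Matrix.mul_assoc, h1, ← Matrix.mul_assoc]
    _ = Y := hY.self_mul_mul

theorem exists_isMoorePenrose [DecidableEq n] (M : Matrix m n ℝ) :
    ∃ X : Matrix n m ℝ, IsMoorePenrose M X := by
  set H : Matrix n n ℝ := Mᵀ * M with hH
  have hsa : IsSelfAdjoint H := by
    rw [hH, IsSelfAdjoint, Matrix.star_eq_conjTranspose, Matrix.conjTranspose_eq_transpose_of_trivial,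
      Matrix.transpose_mul, Matrix.transpose_transpose]
  have hc : ∀ f : ℝ → ℝ, ContinuousOn f (spectrum ℝ H) := fun f =>
    (Matrix.finite_real_spectrum (A := H)).continuousOn f
  set G : Matrix n n ℝ := cfc (fun x : ℝ => x⁻¹) H with hG
  have hid : cfc (fun x : ℝ => x) H = H := cfc_id' ℝ H
  have hGT : Gᵀ = G := by
    have h : IsSelfAdjoint G := cfc_predicate _ _
    rwa [IsSelfAdjoint, Matrix.star_eq_conjTranspose,
      Matrix.conjTranspose_eq_transpose_of_trivial] at h
  have hHT : Hᵀ = H := by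
    rw [hH, Matrix.transpose_mul, Matrix.transpose_transpose]
  have hcomm : G * H = H * G := by
    have h := cfc_commute_cfc (fun x : ℝ => x⁻¹) (fun x : ℝ => x) H
    rw [hid] at h
    exact h
  have hHGH : H * G * H = H := by
    conv_lhs => rw [← hid, hG]
    rw [hid]
    nth_rewrite 1 [← hid]
    nth_rewrite 3 [← hid]
    rw [← cfc_mul _ _ _ (hc _) (hc _), ← cfc_mul _ _ _ (hc _) (hc _)]
    conv_rhs => rw [← hid]
    congr 1
    funext x
    exact mul_inv_mul_cancel x
  have hGHG : G * H * G = G := by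
    nth_rewrite 1 [← hid]
    rw [hG, ← cfc_mul _ _ _ (hc _) (hc _), ← cfc_mul _ _ _ (hc _) (hc _)]
    congr 1
    funext x
    by_cases hx : x = 0 <;> simp [hx]
  have hMGH : M * (G * H) = M := by
    have h0 : (M * (G * H) - M)ᵀ * (M * (G * H) - M) = 0 := by
      have e : (M * (G * H) - M)ᵀ * (M * (G * H) - M)
          = (H * G) * H * (G * H) - (H * G) * H - (H * (G * H) - H) := by
        rw [Matrix.transpose_sub, Matrix.transpose_mul, Matrix.transpose_mul, hGT, hHT,
          Matrix.mul_sub, Matrix.sub_mul, Matrix.sub_mul, hH]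
        simp only [Matrix.mul_assoc]
      rw [e, hHGH, ← Matrix.mul_assoc, hHGH]
      simp
    rw [← Matrix.conjTranspose_eq_transpose_of_trivial,
      Matrix.conjTranspose_mul_self_eq_zero] at h0
    exact sub_eq_zero.mp h0
  refine ⟨G * Mᵀ, ?_, ?_, ?_, ?_⟩
  · rw [Matrix.mul_assoc, Matrix.mul_assoc, ← hH, hMGH]
  · rw [Matrix.mul_assoc G, ← hH, ← Matrix.mul_assoc, hGHG]
  · rw [Matrix.transpose_mul, Matrix.transpose_mul, Matrix.transpose_transpose, hGT,
      Matrix.mul_assoc]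
  · rw [Matrix.mul_assoc, ← hH, Matrix.transpose_mul, hGT, hHT, hcomm]

/-- The Moore-Penrose pseudoinverse `M⁺` of a real matrix, i.e. the unique solution of the
four Penrose equations. -/
noncomputable def pinv [DecidableEq n] (M : Matrix m n ℝ) : Matrix n m ℝ :=
  (exists_isMoorePenrose M).choose

theorem pinv_spec [DecidableEq n] (M : Matrix m n ℝ) : IsMoorePenrose M (pinv M) :=
  (exists_isMoorePenrose M).choose_spec

end PseudoInverse

/-- The largest singular value of a matrix. -/
noncomputable def sigmaMax {m n : ℕ} (M : Matrix (Fin m) (Fin n) ℝ) : ℝ :=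
  (Matrix.toEuclideanLin M).singularValues 0

/-- The smallest singular value of a (nonempty) `m × n` matrix, i.e. the last one of the
`min m n` singular values listed in decreasing order. -/
noncomputable def sigmaMin {m n : ℕ} (M : Matrix (Fin m) (Fin n) ℝ) : ℝ :=
  (Matrix.toEuclideanLin M).singularValues (min m n - 1)

/-- Indices of the `p = p₁ + ⋯ + p_K` unknowns: the pair `⟨k, j⟩` is the `j`-th unknown
of node `k`. -/
abbrev Idx {K : ℕ} (p : Fin K → ℕ) : Type := (k : Fin K) × Fin (p k)

/-- The regressor matrix whose `i`-th row is `a i`. -/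
def regressorMatrix {n : ℕ} {ι : Type*} (a : Fin n → EuclideanSpace ℝ ι) :
    Matrix (Fin n) ι ℝ :=
  Matrix.of fun i j => a i j

section Blocks

variable {n K : ℕ} {p : Fin K → ℕ}

/-- The block `A_k` of the column partition `A = [A_1, …, A_K]`. -/
def colBlock (A : Matrix (Fin n) (Idx p) ℝ) (k : Fin K) : Matrix (Fin n) (Fin (p k)) ℝ :=
  A.submatrix id fun j => ⟨k, j⟩

/-- The `k`-th principal submatrix `Σ_k` of `Σ`. -/
def principalBlock (S : Matrix (Idx p) (Idx p) ℝ) (k : Fin K) :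
    Matrix (Fin (p k)) (Fin (p k)) ℝ :=
  S.submatrix (fun j => ⟨k, j⟩) (fun j => ⟨k, j⟩)

/-- The matrix `Ā = [A_1⁺; …; A_K⁺]` of vertically stacked pseudoinverses. -/
noncomputable def stackedPinv (A : Matrix (Fin n) (Idx p) ℝ) : Matrix (Idx p) (Fin n) ℝ :=
  Matrix.of fun j i => pinv (colBlock A j.1) j.2 i

/-- The matrix `B = I_p - (1 / K) Ā A`. -/
noncomputable def iterationMatrix (A : Matrix (Fin n) (Idx p) ℝ) :
    Matrix (Idx p) (Idx p) ℝ :=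
  1 - (1 / (K : ℝ)) • (stackedPinv A * A)

/-- `ℓ_k(q_k) = (8/3) n σ_max(Σ_k) C (√((p_k + q_k) / n) + (p_k + q_k) / n)`. -/
noncomputable def ell (C : ℝ) (n : ℕ) (S : Matrix (Idx p) (Idx p) ℝ) (q : Fin K → ℝ)
    (k : Fin K) : ℝ :=
  8 / 3 * n * sigmaMax (principalBlock S k) * C *
    (Real.sqrt ((p k + q k) / n) + (p k + q k) / n)

/-- `γ̄_{k,i} = (n σ_max(Σ_k) + ℓ_k(q_k)) / (n σ_min(Σ_i) - ℓ_i(q_i))₊`, as an extended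
nonnegative real: it is `∞` when the positive part in the denominator vanishes (the numerator
being positive). -/
noncomputable def gammaBar (C : ℝ) (n : ℕ) (S : Matrix (Idx p) (Idx p) ℝ) (q : Fin K → ℝ)
    (k i : Fin K) : ℝ≥0∞ :=
  ENNReal.ofReal (n * sigmaMax (principalBlock S k) + ell C n S q k) /
    ENNReal.ofReal (max 0 (n * sigmaMin (principalBlock S i) - ell C n S q i))

/-- `β̄ = √((K - 1)² / K + (1 / K²) ∑_k ∑_{i ≠ k} γ̄_{k,i})`, as an extended nonnegative real. -/
noncomputable def betaBar (C : ℝ) (n : ℕ) (S : Matrix (Idx p) (Idx p) ℝ) (q : Fin K → ℝ) :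
    ℝ≥0∞ :=
  (ENNReal.ofReal (((K : ℝ) - 1) ^ 2 / K) +
    ENNReal.ofReal (1 / (K : ℝ) ^ 2) *
      ∑ k : Fin K, ∑ i ∈ Finset.univ.erase k, gammaBar C n S q k i) ^ (1 / 2 : ℝ)

end Blocks

end Cocoa

-- From here on, the norm of a real matrix is its spectral norm.
open scoped Matrix.Norms.L2Operator

namespace Cocoa

/-! ### Chi-square tails by the Chernoff method. -/

section ChiSquare

/-! The argument separates a deterministic bound on `B` from concentration of the Gram matrices.

Deterministic part: almost surely every `A_k` has full column rank, so `A_k⁺ A_k = I`. The diagonal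
blocks of `B` are then `(1 - 1/K) I` and the others are `-(1/K) A_i⁺ A_k`. The squared norm of `B`
is at most the sum of the squared norms of its blocks (`norm_iterationMatrix_sq_le`); the diagonal
contributes at most `K (1 - 1/K)² = (K - 1)²/K`, and the rest is controlled by `‖A_k‖² ‖A_i⁺‖²`. If
`‖A_k x‖²` differs from `n ⟨Σ_k x, x⟩` by at most `ℓ_k ‖x‖²` for every `k` and `x`, this product is
at most `γ̄_{k,i}` (`norm_sq_mul_norm_pinv_sq_le_gammaBar`).

Probabilistic part (`measureReal_abs_sum_inner_sq_sub_gt_le`): for fixed `x`, `‖A_k x‖²` is a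
multiple of a chi-square variable with `n` degrees of freedom, so it has a Bernstein tail. A net of
at most `5 ^ p_k` points makes the bound uniform in `x` at the price of a factor 2, with failure
probability at most `2 e^{-q_k}`. A union bound over `k` concludes. -/

theorem exp_neg_sub_sq_le_one_sub {u : ℝ} (hu : |u| ≤ 1 / 2) :
    Real.exp (-u - u ^ 2) ≤ 1 - u := by
  obtain ⟨h1, h2⟩ := abs_le.mp hu
  rcases le_total 0 u with h0 | h0
  · have hy := Real.quadratic_le_exp_of_nonneg (show 0 ≤ u + u ^ 2 by positivity)
    have : 1 ≤ (1 - u) * Real.exp (u + u ^ 2) := by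
      refine le_trans ?_ (mul_le_mul_of_nonneg_left hy (by linarith))
      have h3 : 0 ≤ u ^ 2 * (1 - u - u ^ 2 - u ^ 3) := by
        have : u ^ 2 ≤ 1 / 4 := by nlinarith
        have : u ^ 3 ≤ 1 / 8 := by nlinarith
        have : 0 ≤ 1 - u - u ^ 2 - u ^ 3 := by linarith
        positivity
      nlinarith
    have e : Real.exp (-u - u ^ 2) = (Real.exp (u + u ^ 2))⁻¹ := by
      rw [← Real.exp_neg]; ring_nf
    rw [e, inv_le_iff_one_le_mul₀ (Real.exp_pos _)]
    exact this
  · have habs : |-u - u ^ 2| ≤ 1 := by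
      rw [abs_le]; constructor <;> nlinarith
    have := (abs_le.mp (Real.abs_exp_sub_one_sub_id_le habs)).2
    have h3 : (-u - u ^ 2) ^ 2 ≤ u ^ 2 := by
      have e : (-u - u ^ 2) ^ 2 = u ^ 2 * (1 + u) ^ 2 := by ring
      rw [e]
      exact mul_le_of_le_one_right (sq_nonneg _) (by nlinarith)
    linarith

theorem exp_mul_sq_sub_one_smul_gaussianPDF (u x : ℝ) :
    gaussianPDFReal 0 1 x • Real.exp (u * (x ^ 2 - 1)) =
      ((Real.sqrt (2 * Real.pi))⁻¹ * Real.exp (-u)) * Real.exp (-(1 / 2 - u) * x ^ 2) := by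
  rw [gaussianPDFReal, smul_eq_mul, mul_assoc (_⁻¹), mul_assoc (_⁻¹), ← Real.exp_add, ← Real.exp_add]
  simp only [NNReal.coe_one, mul_one, sub_zero]
  ring_nf

theorem integrable_exp_mul_sq_sub_one {u : ℝ} (hu : u < 1 / 2) :
    Integrable (fun x : ℝ => Real.exp (u * (x ^ 2 - 1))) (gaussianReal 0 1) := by
  rw [gaussianReal_of_var_ne_zero _ one_ne_zero,
    integrable_withDensity_iff_integrable_smul' (measurable_gaussianPDF _ _)
      (ae_of_all _ fun _ => gaussianPDF_lt_top)]
  simp only [toReal_gaussianPDF, exp_mul_sq_sub_one_smul_gaussianPDF]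
  exact (integrable_exp_neg_mul_sq (by linarith)).const_mul _

/-- The moment generating function is exactly `e^{-u} (1 - 2u)^{-1/2}`; the bound is the square root
of `exp_neg_sub_sq_le_one_sub` at `2u`. -/
theorem mgf_sq_sub_one_le {u : ℝ} (hu : |u| ≤ 1 / 4) :
    mgf (fun x : ℝ => x ^ 2 - 1) (gaussianReal 0 1) u ≤ Real.exp (2 * u ^ 2) := by
  obtain ⟨h1, h2⟩ := abs_le.mp hu
  rw [mgf, integral_gaussianReal_eq_integral_smul one_ne_zero]
  simp only [exp_mul_sq_sub_one_smul_gaussianPDF]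
  rw [integral_const_mul, integral_gaussian]
  have hpos : 0 < 1 - 2 * u := by linarith
  have key := exp_neg_sub_sq_le_one_sub (u := 2 * u) (by rw [abs_le]; constructor <;> linarith)
  have e : (Real.sqrt (2 * Real.pi))⁻¹ * Real.exp (-u) * Real.sqrt (Real.pi / (1 / 2 - u))
      = Real.exp (-u) * (Real.sqrt (1 - 2 * u))⁻¹ := by
    have : Real.pi / (1 / 2 - u) = 2 * Real.pi / (1 - 2 * u) := by
      have : (1 / 2 - u) ≠ 0 := by linarith
      field_simp
    rw [this, Real.sqrt_div (by positivity)]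
    have : Real.sqrt (2 * Real.pi) ≠ 0 := by positivity
    field_simp
  rw [e, ← div_eq_mul_inv, div_le_iff₀ (by positivity)]
  have h3 : Real.exp (-u - 2 * u ^ 2) ≤ Real.sqrt (1 - 2 * u) := by
    apply Real.le_sqrt_of_sq_le
    rw [← Real.exp_nat_mul]
    refine le_trans (le_of_eq ?_) key
    congr 1; push_cast; ring
  calc Real.exp (-u) = Real.exp (2 * u ^ 2) * Real.exp (-u - 2 * u ^ 2) := by
        rw [← Real.exp_add]; ring_nf
    _ ≤ _ := mul_le_mul_of_nonneg_left h3 (Real.exp_pos _).le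

variable {Ω : Type*} [MeasurableSpace Ω] {P : Measure Ω} [IsProbabilityMeasure P] {n : ℕ}

/-- The parameter `min t 1 / 4` minimises `-ut + 2u²` over `0 ≤ u ≤ 1/4`, the range allowed by
`mgf_sq_sub_one_le`. -/
theorem chernoff_exponent_le {t : ℝ} (ht : 0 ≤ t) :
    -(min t 1 / 4) * t + 2 * (min t 1 / 4) ^ 2 ≤ -(min (t ^ 2) t / 8) := by
  rcases le_total t 1 with h | h
  · rw [min_eq_left h, min_eq_left (by nlinarith)]; nlinarith
  · rw [min_eq_right h, min_eq_right (by nlinarith)]; nlinarith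

theorem measureReal_abs_sum_sq_sub_one_ge_le {X : Fin n → Ω → ℝ}
    (hX : ∀ i, HasLaw (X i) (gaussianReal 0 1) P) (hind : iIndepFun X P) {t : ℝ} (ht : 0 ≤ t) :
    P.real {ω | n * t ≤ |∑ i, (X i ω ^ 2 - 1)|} ≤
      2 * Real.exp (-(n * (min (t ^ 2) t / 8))) := by
  set Y : Fin n → Ω → ℝ := fun i ω => X i ω ^ 2 - 1 with hY
  have hf : Measurable (fun x : ℝ => x ^ 2 - 1) := by fun_prop
  have hYind : iIndepFun Y P := hind.comp (fun _ x => x ^ 2 - 1) (fun _ => hf)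
  have hYm : ∀ i, AEMeasurable (Y i) P := fun i => hf.comp_aemeasurable (hX i).aemeasurable
  have hmgf : ∀ i u, mgf (Y i) P u = mgf (fun x : ℝ => x ^ 2 - 1) (gaussianReal 0 1) u := by
    intro i u
    rw [mgf, mgf, ← (hX i).map_eq, integral_map (hX i).aemeasurable (by fun_prop)]
  have hint : ∀ u : ℝ, u < 1 / 2 → Integrable (fun ω => Real.exp (u * (∑ i, Y i) ω)) P := by
    intro u hu
    have hi : ∀ i, Integrable (fun ω => Real.exp (u * Y i ω)) P := fun i => by
      have := integrable_exp_mul_sq_sub_one hu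
      rw [← (hX i).map_eq, integrable_map_measure (by fun_prop) (hX i).aemeasurable] at this
      exact this
    -- Without integrability the integral takes the default value 0, whereas independence makes it a
    -- product of positive factors.
    by_contra hnot
    have h0 : mgf (∑ i, Y i) P u = 0 := integral_undef hnot
    rw [hYind.mgf_sum₀ hYm] at h0
    exact (Finset.prod_pos fun i _ => mgf_pos (hi i)).ne' h0
  have hsum : ∀ u : ℝ, |u| ≤ 1 / 4 → mgf (∑ i, Y i) P u ≤ Real.exp (n * (2 * u ^ 2)) := by
    intro u hu
    rw [hYind.mgf_sum₀ hYm, Real.exp_nat_mul]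
    refine (Finset.prod_le_prod (fun i _ => mgf_nonneg)
      fun i _ => (hmgf i u).trans_le (mgf_sq_sub_one_le hu)).trans (le_of_eq ?_)
    simp
  set u := min t 1 / 4 with hu
  have hu0 : 0 ≤ u := by positivity
  have hu1 : u ≤ 1 / 4 := by
    have := min_le_right t 1
    rw [hu]; linarith
  have hexp : -u * (n * t) + n * (2 * u ^ 2) ≤ -(n * (min (t ^ 2) t / 8)) := by
    have := mul_le_mul_of_nonneg_left (chernoff_exponent_le ht) (Nat.cast_nonneg (α := ℝ) n)
    rw [← hu] at this
    linarith
  have up : P.real {ω | n * t ≤ (∑ i, Y i) ω} ≤ Real.exp (-(n * (min (t ^ 2) t / 8))) := by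
    refine (measure_ge_le_exp_mul_mgf _ hu0 (hint u (by linarith))).trans ?_
    refine (mul_le_mul_of_nonneg_left (hsum u (by rw [abs_of_nonneg hu0]; exact hu1))
      (Real.exp_pos _).le).trans ?_
    rw [← Real.exp_add]
    exact Real.exp_le_exp.mpr hexp
  have lo : P.real {ω | (∑ i, Y i) ω ≤ -(n * t)} ≤ Real.exp (-(n * (min (t ^ 2) t / 8))) := by
    refine (measure_le_le_exp_mul_mgf _ (neg_nonpos.mpr hu0) (hint (-u) (by linarith))).trans ?_
    refine (mul_le_mul_of_nonneg_left (hsum (-u) (by rw [abs_neg, abs_of_nonneg hu0]; exact hu1))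
      (Real.exp_pos _).le).trans ?_
    rw [← Real.exp_add]
    refine Real.exp_le_exp.mpr (le_trans (le_of_eq ?_) hexp)
    ring
  calc P.real {ω | n * t ≤ |∑ i, (X i ω ^ 2 - 1)|}
      ≤ P.real ({ω | n * t ≤ (∑ i, Y i) ω} ∪ {ω | (∑ i, Y i) ω ≤ -(n * t)}) := by
        refine measureReal_mono fun ω hω => ?_
        simp only [Set.mem_ofPred_eq, Set.mem_union, Finset.sum_apply] at hω ⊢
        rcases le_abs.mp hω with h | h
        · exact Or.inl h
        · exact Or.inr (by linarith)
    _ ≤ _ := (measureReal_union_le _ _).trans (by linarith)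

end ChiSquare

/-! ### Nets on the sphere and quadratic forms. -/

section Net

variable {E : Type*} [NormedAddCommGroup E] [InnerProductSpace ℝ E] [FiniteDimensional ℝ E]

variable (E) in
-- A 1-separated subset of the sphere of maximal cardinality is a net. Radius 2 and separation 1 are
-- the scale of the volume bound `Besicovitch.card_le_of_separated`.
theorem exists_finset_net_sphere :
    ∃ s : Finset E, s.card ≤ 5 ^ Module.finrank ℝ E ∧ (∀ c ∈ s, ‖c‖ = 2) ∧
      ∀ x : E, ‖x‖ = 2 → ∃ c ∈ s, ‖c - x‖ < 1 := by
  classical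
  let Sep : Finset E → Prop := fun s =>
    (∀ c ∈ s, ‖c‖ = 2) ∧ ∀ c ∈ s, ∀ d ∈ s, c ≠ d → 1 ≤ ‖c - d‖
  have hbound : ∀ s, Sep s → s.card ≤ 5 ^ Module.finrank ℝ E := fun s hs =>
    Besicovitch.card_le_of_separated s (fun c hc => (hs.1 c hc).le) hs.2
  let T : Set ℕ := {m | ∃ s, Sep s ∧ s.card = m}
  have hT : T.Nonempty := ⟨0, ∅, by simp [Sep], by simp⟩
  have hTb : BddAbove T := ⟨5 ^ Module.finrank ℝ E, by rintro _ ⟨s, hs, rfl⟩; exact hbound s hs⟩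
  obtain ⟨s, hs, hcard⟩ := Nat.sSup_mem hT hTb
  refine ⟨s, hbound s hs, hs.1, fun x hx => ?_⟩
  by_contra! hfar
  have hxs : x ∉ s := fun h => by have := hfar x h; simp at this; linarith
  have hins : Sep (insert x s) := by
    refine ⟨?_, ?_⟩
    · intro c hc
      rcases Finset.mem_insert.mp hc with rfl | hc
      exacts [hx, hs.1 c hc]
    · intro c hc d hd hcd
      rcases Finset.mem_insert.mp hc with hcx | hcs <;>
        rcases Finset.mem_insert.mp hd with hdx | hds
      · exact absurd (hcx.trans hdx.symm) hcd
      · rw [hcx, norm_sub_rev]; exact hfar d hds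
      · rw [hdx]; exact hfar c hcs
      · exact hs.2 c hcs d hds hcd
  have := le_csSup hTb (show (insert x s).card ∈ T from ⟨_, hins, rfl⟩)
  rw [Finset.card_insert_of_notMem hxs, hcard] at this
  omega

theorem inner_apply_self_eq_sum_eigenvalues {T : E →ₗ[ℝ] E} (hT : T.IsSymmetric) {d : ℕ}
    (hd : Module.finrank ℝ E = d) (x : E) :
    inner ℝ (T x) x =
      ∑ i, hT.eigenvalues hd i * ((hT.eigenvectorBasis hd).repr x i) ^ 2 := by
  rw [← (hT.eigenvectorBasis hd).repr.inner_map_map, PiLp.inner_apply]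
  refine Finset.sum_congr rfl fun i _ => ?_
  rw [hT.eigenvectorBasis_apply_self_apply hd]
  simp; ring

omit [FiniteDimensional ℝ E] in
theorem sum_repr_sq_eq_norm_sq {ι : Type*} [Fintype ι] (b : OrthonormalBasis ι ℝ E) (x : E) :
    ∑ i, (b.repr x i) ^ 2 = ‖x‖ ^ 2 := by
  rw [← b.repr.norm_map x, EuclideanSpace.real_norm_sq_eq]

/-- The net is compared with an eigenvector `v` of the eigenvalue `λ` of largest modulus. As `c = v
+ e` has the same norm as `v`, the cross term is second order: `⟨Tc, c⟩ = λ (4 - ‖e‖²) + ⟨Te, e⟩`.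
Hence `|λ| (4 - 2‖e‖²) ≤ 4r`, and `‖e‖ ≤ 1` gives `|λ| ≤ 2r`. The cruder estimate `1 - 2ε` would be
void for this net, where `ε = 1/2` relative to the radius. -/
theorem abs_inner_apply_self_le_of_net {T : E →ₗ[ℝ] E} (hT : T.IsSymmetric) {s : Finset E}
    (hs : ∀ c ∈ s, ‖c‖ = 2) (hnet : ∀ x : E, ‖x‖ = 2 → ∃ c ∈ s, ‖c - x‖ < 1) {r : ℝ}
    (hr : ∀ c ∈ s, |inner ℝ (T c) c| ≤ r * ‖c‖ ^ 2) (x : E) :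
    |inner ℝ (T x) x| ≤ 2 * r * ‖x‖ ^ 2 := by
  classical
  by_cases hdim : Module.finrank ℝ E = 0
  · have : Subsingleton E := Module.finrank_zero_iff.mp hdim
    simp [Subsingleton.elim x 0]
  set d := Module.finrank ℝ E with hd
  let b := hT.eigenvectorBasis hd.symm
  let lam := hT.eigenvalues hd.symm
  have : Nonempty (Fin d) := ⟨⟨0, Nat.pos_of_ne_zero hdim⟩⟩
  obtain ⟨j, -, hj⟩ := Finset.exists_max_image (Finset.univ : Finset (Fin d)) (fun i => |lam i|)
    Finset.univ_nonempty
  have hj' : ∀ i, |lam i| ≤ |lam j| := fun i => hj i (Finset.mem_univ i)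
  have hquad : ∀ y : E, |inner ℝ (T y) y| ≤ |lam j| * ‖y‖ ^ 2 := by
    intro y
    rw [inner_apply_self_eq_sum_eigenvalues hT hd.symm, ← sum_repr_sq_eq_norm_sq b,
      Finset.mul_sum]
    refine (Finset.abs_sum_le_sum_abs _ _).trans (Finset.sum_le_sum fun i _ => ?_)
    rw [abs_mul, abs_of_nonneg (sq_nonneg (b.repr y i))]
    exact mul_le_mul_of_nonneg_right (hj' i) (sq_nonneg _)
  have hlam : |lam j| ≤ 2 * r := by
    obtain ⟨v, hv⟩ : ∃ v : E, v = (2 : ℝ) • b j := ⟨_, rfl⟩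
    have hvn : ‖v‖ = 2 := by rw [hv, norm_smul, b.orthonormal.1 j]; simp
    have hTv : T v = lam j • v := by
      rw [hv, map_smul, hT.apply_eigenvectorBasis hd.symm j, smul_comm]; rfl
    obtain ⟨c, hc, hcv⟩ := hnet v hvn
    set e := c - v with he
    have hce : c = v + e := by rw [he]; abel
    have hve : 2 * inner ℝ v e = -‖e‖ ^ 2 := by
      have h := norm_add_sq_real v e
      rw [← hce, hs c hc, hvn] at h
      linarith
    have hexp : inner ℝ (T c) c = lam j * (4 - ‖e‖ ^ 2) + inner ℝ (T e) e := by
      rw [hce, map_add, inner_add_left, inner_add_right, inner_add_right, hT e v, hTv,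
        real_inner_smul_left, real_inner_smul_left, real_inner_smul_right,
        real_inner_self_eq_norm_sq, hvn, real_inner_comm v e]
      have : inner ℝ v e = -‖e‖ ^ 2 / 2 := by linarith
      rw [this]; ring
    have he1 : ‖e‖ ^ 2 ≤ 1 := by
      have := norm_nonneg e
      nlinarith
    have h1 := hr c hc
    have h2 := hquad e
    rw [hs c hc, hexp] at h1
    have h3 : |lam j * (4 - ‖e‖ ^ 2)| ≤ r * 2 ^ 2 + |lam j| * ‖e‖ ^ 2 := by
      have := abs_sub (lam j * (4 - ‖e‖ ^ 2) + inner ℝ (T e) e) (inner ℝ (T e) e)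
      rw [add_sub_cancel_right] at this
      linarith
    rw [abs_mul, abs_of_nonneg (by linarith : (0 : ℝ) ≤ 4 - ‖e‖ ^ 2)] at h3
    nlinarith [abs_nonneg (lam j)]
  exact (hquad x).trans (mul_le_mul_of_nonneg_right hlam (sq_nonneg _))

end Net

/-! ### Extreme singular values and quadratic forms. -/

section SingularValues

variable {E F : Type*} [NormedAddCommGroup E] [InnerProductSpace ℝ E] [FiniteDimensional ℝ E]
  [NormedAddCommGroup F] [InnerProductSpace ℝ F] [FiniteDimensional ℝ F]

theorem norm_apply_sq_eq_sum_singularValues (T : E →ₗ[ℝ] F) {d : ℕ}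
    (hd : Module.finrank ℝ E = d) (x : E) :
    ‖T x‖ ^ 2 = ∑ i : Fin d, T.singularValues i ^ 2 *
      ((T.isSymmetric_adjoint_comp_self.eigenvectorBasis hd).repr x i) ^ 2 := by
  have h := inner_apply_self_eq_sum_eigenvalues T.isSymmetric_adjoint_comp_self hd x
  rw [LinearMap.comp_apply, LinearMap.adjoint_inner_left, real_inner_self_eq_norm_sq] at h
  rw [h]
  exact Finset.sum_congr rfl fun i _ => by rw [T.sq_singularValues_fin hd]

theorem norm_apply_le_singularValues_zero_mul (T : E →ₗ[ℝ] F) (x : E) :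
    ‖T x‖ ≤ T.singularValues 0 * ‖x‖ := by
  refine le_of_sq_le_sq ?_ (mul_nonneg (T.singularValues_nonneg _) (norm_nonneg _))
  rw [norm_apply_sq_eq_sum_singularValues T rfl, mul_pow,
    ← sum_repr_sq_eq_norm_sq (T.isSymmetric_adjoint_comp_self.eigenvectorBasis rfl) x,
    Finset.mul_sum]
  refine Finset.sum_le_sum fun i _ => mul_le_mul_of_nonneg_right ?_ (sq_nonneg _)
  exact pow_le_pow_left₀ (T.singularValues_nonneg _) (T.singularValues_antitone (Nat.zero_le _)) 2

/-- The hypothesis places every index below the dimension at or before `m`. Writing it with `m + 1`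
also covers dimension 0, where the index in `sigmaMin` truncates to 0. -/
theorem singularValues_mul_norm_le (T : E →ₗ[ℝ] F) {m : ℕ}
    (hm : Module.finrank ℝ E ≤ m + 1) (x : E) :
    T.singularValues m * ‖x‖ ≤ ‖T x‖ := by
  refine le_of_sq_le_sq ?_ (norm_nonneg _)
  rw [norm_apply_sq_eq_sum_singularValues T rfl, mul_pow,
    ← sum_repr_sq_eq_norm_sq (T.isSymmetric_adjoint_comp_self.eigenvectorBasis rfl) x,
    Finset.mul_sum]
  refine Finset.sum_le_sum fun i _ => mul_le_mul_of_nonneg_right ?_ (sq_nonneg _)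
  exact pow_le_pow_left₀ (T.singularValues_nonneg _) (T.singularValues_antitone (by omega)) 2

theorem mul_norm_sq_le_inner_of_isPositive {T : E →ₗ[ℝ] E} (hT : T.IsPositive) {r : ℝ}
    (h : ∀ x, r * ‖x‖ ≤ ‖T x‖) (x : E) : r * ‖x‖ ^ 2 ≤ inner ℝ (T x) x := by
  have hsym := hT.isSymmetric
  rw [inner_apply_self_eq_sum_eigenvalues hsym rfl, ← sum_repr_sq_eq_norm_sq
    (hsym.eigenvectorBasis rfl), Finset.mul_sum]
  refine Finset.sum_le_sum fun i _ => mul_le_mul_of_nonneg_right ?_ (sq_nonneg _)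
  have h1 := h (hsym.eigenvectorBasis rfl i)
  rw [hsym.apply_eigenvectorBasis, norm_smul, (hsym.eigenvectorBasis rfl).orthonormal.1 i] at h1
  have h2 := hT.nonneg_eigenvalues rfl i
  simpa [abs_of_nonneg h2] using h1

variable {d : ℕ} {M : Matrix (Fin d) (Fin d) ℝ}

theorem inner_toEuclideanLin_le_sigmaMax (x : EuclideanSpace ℝ (Fin d)) :
    inner ℝ (Matrix.toEuclideanLin M x) x ≤ sigmaMax M * ‖x‖ ^ 2 := by
  refine (real_inner_le_norm _ _).trans ?_
  rw [sq, ← mul_assoc]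
  exact mul_le_mul_of_nonneg_right (norm_apply_le_singularValues_zero_mul _ x) (norm_nonneg _)

theorem sigmaMin_mul_le_inner_toEuclideanLin (hM : M.PosSemidef) (x : EuclideanSpace ℝ (Fin d)) :
    sigmaMin M * ‖x‖ ^ 2 ≤ inner ℝ (Matrix.toEuclideanLin M x) x := by
  refine mul_norm_sq_le_inner_of_isPositive (Matrix.isPositive_toEuclideanLin_iff.mpr hM) ?_ x
  intro y
  refine singularValues_mul_norm_le _ ?_ y
  simp; omega

theorem sigmaMax_pos (hM : M.PosDef) (hd : 0 < d) : 0 < sigmaMax M := by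
  refine lt_of_le_of_ne ((Matrix.toEuclideanLin M).singularValues_nonneg 0) fun h => ?_
  have h0 : Matrix.toEuclideanLin M = 0 := by
    ext1 x
    have := norm_apply_le_singularValues_zero_mul (Matrix.toEuclideanLin M) x
    rw [sigmaMax] at h
    rw [← h, zero_mul] at this
    simpa using this
  have hM0 : M = 0 := by simpa using h0
  have := hM.diag_pos (i := ⟨0, hd⟩)
  simp [hM0] at this

end SingularValues

/-! ### Almost sure full column rank. -/

section FullRank

variable {E : Type*} [NormedAddCommGroup E] [InnerProductSpace ℝ E] [FiniteDimensional ℝ E]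
  [MeasurableSpace E] [BorelSpace E]

omit [BorelSpace E] in
theorem measure_submodule_eq_zero {μ : Measure E}
    (hμ : ∀ v : E, v ≠ 0 → μ {y | inner ℝ v y = 0} = 0) {W : Submodule ℝ E} (hW : W ≠ ⊤) :
    μ W = 0 := by
  have hWo : Wᗮ ≠ ⊥ := fun h => hW (Submodule.orthogonal_eq_bot_iff.mp h)
  obtain ⟨v, hv, hv0⟩ := Submodule.exists_mem_ne_zero_of_ne_bot hWo
  refine measure_mono_null (fun y hy => ?_) (hμ v hv0)
  exact (Submodule.mem_orthogonal' W v).mp hv y hy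

/-- Induction on the number of vectors: fewer than `dim E` vectors span a proper subspace, which is
null, so an independent new vector almost surely avoids it. -/
theorem ae_linearIndependent_pi {μ : Measure E} [IsProbabilityMeasure μ]
    (hμ : ∀ v : E, v ≠ 0 → μ {y | inner ℝ v y = 0} = 0) :
    ∀ m : ℕ, m ≤ Module.finrank ℝ E →
      ∀ᵐ w ∂(Measure.pi fun _ : Fin m => μ), LinearIndependent ℝ w
  | 0, _ => Filter.Eventually.of_forall fun _ => linearIndependent_empty_type
  | m + 1, hm => by
    have ih := ae_linearIndependent_pi hμ m (by omega)
    have hmeas : MeasurableSet {w : Fin (m + 1) → E | LinearIndependent ℝ w} :=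
      isOpen_setOfPred_linearIndependent.measurableSet
    have hmp := (measurePreserving_piFinSuccAbove (fun _ : Fin (m + 1) => μ) 0).symm
    have hmeas' : MeasurableSet {z : E × (Fin m → E) |
        LinearIndependent ℝ ((MeasurableEquiv.piFinSuccAbove (fun _ => E) 0).symm z)} :=
      hmp.measurable hmeas
    -- Fubini, with the order exchanged so that the tail `v` is fixed before the new vector `x`.
    rw [← hmp.map_eq, ae_map_iff hmp.measurable.aemeasurable hmeas,
      Measure.ae_prod_iff_ae_ae hmeas', Measure.ae_ae_comm hmeas']
    filter_upwards [ih] with v hv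
    have hspan : Submodule.span ℝ (Set.range v) ≠ ⊤ := by
      intro h
      have := finrank_range_le_card (R := ℝ) v
      rw [Set.finrank, h, finrank_top, Fintype.card_fin] at this
      omega
    have hnull := measure_submodule_eq_zero hμ hspan
    filter_upwards [measure_eq_zero_iff_ae_notMem.mp hnull] with x hx
    have hcons : (MeasurableEquiv.piFinSuccAbove (fun _ : Fin (m + 1) => E) 0).symm (x, v) =
        Fin.cons x v := Fin.insertNth_zero' x v
    rw [hcons]
    exact hv.finCons hx

variable {Ω : Type*} [MeasurableSpace Ω] {P : Measure Ω} {n : ℕ}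

theorem ae_forall_inner_eq_zero_imp {μ : Measure E} [IsProbabilityMeasure μ]
    (hμ : ∀ v : E, v ≠ 0 → μ {y | inner ℝ v y = 0} = 0) {b : Fin n → Ω → E}
    (hb : ∀ i, HasLaw (b i) μ P) (hind : iIndepFun b P) (hn : Module.finrank ℝ E ≤ n) :
    ∀ᵐ ω ∂P, ∀ x : E, (∀ i, inner ℝ (b i ω) x = 0) → x = 0 := by
  have hind' := hind.precomp (Fin.castLE_injective hn)
  have hlaw : HasLaw (fun ω i => b (Fin.castLE hn i) ω)
      (Measure.pi fun _ : Fin (Module.finrank ℝ E) => μ) P :=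
    hind'.hasLaw_pi fun i => hb _
  have hae := ae_linearIndependent_pi hμ (Module.finrank ℝ E) le_rfl
  rw [← hlaw.map_eq] at hae
  filter_upwards [ae_of_ae_map hlaw.aemeasurable hae] with ω hω x hx
  have htop := hω.span_eq_top_of_card_eq_finrank' (by simp)
  have hle : Submodule.span ℝ (Set.range fun i => b (Fin.castLE hn i) ω) ≤ (ℝ ∙ x)ᗮ := by
    rw [Submodule.span_le]
    rintro _ ⟨i, rfl⟩
    exact Submodule.mem_orthogonal_singleton_iff_inner_left.mpr (hx _)
  have hxx : x ∈ (ℝ ∙ x)ᗮ := hle (htop ▸ Submodule.mem_top)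
  exact inner_self_eq_zero.mp (Submodule.mem_orthogonal_singleton_iff_inner_left.mp hxx)

end FullRank

/-! ### Spectral norms of matrices and pseudoinverses. -/

section OperatorNorm

variable {m n : Type*} [Fintype m] [Fintype n] [DecidableEq n]

theorem norm_toEuclideanLin_le (M : Matrix m n ℝ) (x : EuclideanSpace ℝ n) :
    ‖Matrix.toEuclideanLin M x‖ ≤ ‖M‖ * ‖x‖ :=
  Matrix.l2_opNorm_mulVec M x

theorem l2_opNorm_sq_le {M : Matrix m n ℝ} {r : ℝ} (hr : 0 ≤ r)
    (h : ∀ x : EuclideanSpace ℝ n, ‖Matrix.toEuclideanLin M x‖ ^ 2 ≤ r * ‖x‖ ^ 2) :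
    ‖M‖ ^ 2 ≤ r := by
  have : ‖M‖ ≤ Real.sqrt r := by
    rw [Matrix.l2_opNorm_def]
    refine ContinuousLinearMap.opNorm_le_bound _ (Real.sqrt_nonneg _) fun x => ?_
    refine le_of_sq_le_sq ?_ (by positivity)
    rw [mul_pow, Real.sq_sqrt hr]
    exact h x
  calc ‖M‖ ^ 2 ≤ Real.sqrt r ^ 2 := pow_le_pow_left₀ (norm_nonneg _) this 2
    _ = r := Real.sq_sqrt hr

theorem norm_le_one_of_isSymm_of_idempotent {Q : Matrix n n ℝ} (hs : Qᵀ = Q) (hi : Q * Q = Q) :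
    ‖Q‖ ≤ 1 := by
  have h := Matrix.l2_opNorm_conjTranspose_mul_self Q
  rw [Matrix.conjTranspose_eq_transpose_of_trivial, hs, hi] at h
  by_contra! h1
  nlinarith

omit [Fintype m] in
theorem toEuclideanLin_mul_apply {l : Type*} [Fintype l] [DecidableEq l] (M : Matrix m n ℝ)
    (N : Matrix n l ℝ) (x : EuclideanSpace ℝ l) :
    Matrix.toEuclideanLin (M * N) x = Matrix.toEuclideanLin M (Matrix.toEuclideanLin N x) := by
  simp [Matrix.toLpLin_apply, Matrix.mulVec_mulVec]

/-- Since `M M⁺` is an orthogonal projection, `r ‖M⁺ y‖² ≤ ‖M M⁺ y‖² ≤ ‖y‖²`. -/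
theorem norm_pinv_sq_le [DecidableEq m] {M : Matrix m n ℝ} {r : ℝ} (hr : 0 < r)
    (h : ∀ x : EuclideanSpace ℝ n, r * ‖x‖ ^ 2 ≤ ‖Matrix.toEuclideanLin M x‖ ^ 2) :
    ‖pinv M‖ ^ 2 ≤ 1 / r := by
  have hpi := pinv_spec M
  have hQ : ‖M * pinv M‖ ≤ 1 := norm_le_one_of_isSymm_of_idempotent hpi.transpose_left
    (by rw [← Matrix.mul_assoc, hpi.mul_mul_self])
  refine l2_opNorm_sq_le (by positivity) fun y => ?_
  rw [one_div_mul_eq_div, le_div_iff₀ hr, mul_comm]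
  refine (h _).trans (pow_le_pow_left₀ (norm_nonneg _) ?_ 2)
  rw [← toEuclideanLin_mul_apply]
  refine (norm_toEuclideanLin_le _ y).trans ?_
  exact mul_le_of_le_one_left (norm_nonneg _) hQ

theorem pinv_mul_self_eq_one {M : Matrix m n ℝ}
    (h : ∀ x : EuclideanSpace ℝ n, Matrix.toEuclideanLin M x = 0 → x = 0) : pinv M * M = 1 := by
  apply Matrix.toEuclideanLin.injective
  ext1 x
  rw [← sub_eq_zero]
  apply h
  rw [map_sub, ← toEuclideanLin_mul_apply, ← Matrix.mul_assoc, (pinv_spec M).mul_mul_self]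
  simp

end OperatorNorm

/-! ### The deterministic bound on the iteration matrix. -/

section Blocks

variable {K : ℕ} {p : Fin K → ℕ}

/-- The `(k, i)` block of a matrix indexed by `Idx p`. -/
def block (M : Matrix (Idx p) (Idx p) ℝ) (k i : Fin K) : Matrix (Fin (p k)) (Fin (p i)) ℝ :=
  M.submatrix (fun j => ⟨k, j⟩) (fun j => ⟨i, j⟩)

/-- The `k`-th block of a vector indexed by `Idx p`. -/
def vecBlock (k : Fin K) (x : EuclideanSpace ℝ (Idx p)) : EuclideanSpace ℝ (Fin (p k)) :=
  WithLp.toLp 2 fun j => x ⟨k, j⟩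

theorem sum_norm_vecBlock_sq (x : EuclideanSpace ℝ (Idx p)) :
    ∑ k, ‖vecBlock k x‖ ^ 2 = ‖x‖ ^ 2 := by
  simp only [EuclideanSpace.real_norm_sq_eq, Fintype.sum_sigma, vecBlock]

theorem vecBlock_toEuclideanLin (M : Matrix (Idx p) (Idx p) ℝ) (k : Fin K)
    (x : EuclideanSpace ℝ (Idx p)) :
    vecBlock k (Matrix.toEuclideanLin M x) =
      ∑ i, Matrix.toEuclideanLin (block M k i) (vecBlock i x) := by
  ext j
  simp [vecBlock, block, Matrix.toLpLin_apply, Matrix.mulVec, dotProduct, Fintype.sum_sigma]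

theorem l2_opNorm_sq_le_sum_block (M : Matrix (Idx p) (Idx p) ℝ) :
    ‖M‖ ^ 2 ≤ ∑ k, ∑ i, ‖block M k i‖ ^ 2 := by
  refine l2_opNorm_sq_le (by positivity) fun x => ?_
  rw [← sum_norm_vecBlock_sq (Matrix.toEuclideanLin M x), Finset.sum_mul]
  refine Finset.sum_le_sum fun k _ => ?_
  rw [vecBlock_toEuclideanLin, ← sum_norm_vecBlock_sq x]
  refine le_trans (pow_le_pow_left₀ (norm_nonneg _) ?_ 2)
    (Finset.sum_mul_sq_le_sq_mul_sq Finset.univ (fun i => ‖block M k i‖) fun i => ‖vecBlock i x‖)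
  exact (norm_sum_le _ _).trans (Finset.sum_le_sum fun i _ => norm_toEuclideanLin_le _ _)

variable {n : ℕ}

theorem block_iterationMatrix_self {A : Matrix (Fin n) (Idx p) ℝ} {k : Fin K}
    (h : pinv (colBlock A k) * colBlock A k = 1) :
    block (iterationMatrix A) k k = (1 - 1 / (K : ℝ)) • 1 := by
  rw [sub_smul, one_smul, ← h]
  -- The first identity matrix is restored; only the one multiplied by `1 / K` stays in the form
  -- `A_k⁺ A_k`.
  nth_rewrite 1 [h]
  ext j l
  simp [block, iterationMatrix, stackedPinv, colBlock, Matrix.mul_apply, Matrix.one_apply]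

theorem block_iterationMatrix_of_ne {A : Matrix (Fin n) (Idx p) ℝ} {k i : Fin K} (hki : k ≠ i) :
    block (iterationMatrix A) k i = -(1 / (K : ℝ)) • (pinv (colBlock A k) * colBlock A i) := by
  ext j l
  simp [block, iterationMatrix, stackedPinv, colBlock, Matrix.mul_apply, hki]

theorem norm_iterationMatrix_sq_le {A : Matrix (Fin n) (Idx p) ℝ} (hK : 0 < K)
    (h : ∀ k, pinv (colBlock A k) * colBlock A k = 1) :
    ‖iterationMatrix A‖ ^ 2 ≤ ((K : ℝ) - 1) ^ 2 / K + 1 / (K : ℝ) ^ 2 *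
      ∑ k, ∑ i ∈ Finset.univ.erase k, ‖colBlock A k‖ ^ 2 * ‖pinv (colBlock A i)‖ ^ 2 := by
  have hK0 : (0 : ℝ) < K := by exact_mod_cast hK
  refine (l2_opNorm_sq_le_sum_block _).trans ?_
  have hdiag : ∀ k, ‖block (iterationMatrix A) k k‖ ^ 2 ≤ (1 - 1 / (K : ℝ)) ^ 2 := by
    intro k
    rw [block_iterationMatrix_self (h k), norm_smul, mul_pow, Real.norm_eq_abs, sq_abs]
    refine mul_le_of_le_one_right (sq_nonneg _) ?_
    exact pow_le_one₀ (norm_nonneg _)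
      (norm_le_one_of_isSymm_of_idempotent Matrix.transpose_one (mul_one _))
  have hoff : ∀ i k, i ≠ k → ‖block (iterationMatrix A) i k‖ ^ 2 ≤
      1 / (K : ℝ) ^ 2 * (‖colBlock A k‖ ^ 2 * ‖pinv (colBlock A i)‖ ^ 2) := by
    intro i k hik
    rw [block_iterationMatrix_of_ne hik, norm_smul, mul_pow, norm_neg, Real.norm_eq_abs, sq_abs,
      div_pow, one_pow, ← mul_pow, mul_comm ‖colBlock A k‖]
    exact mul_le_mul_of_nonneg_left
      (pow_le_pow_left₀ (norm_nonneg _) (Matrix.l2_opNorm_mul _ _) 2) (by positivity)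
  -- The outer index becomes the column block `k`, the one in the numerator of `γ̄_{k,i}`.
  rw [Finset.sum_comm]
  have hrow : ∀ k, ∑ i, ‖block (iterationMatrix A) i k‖ ^ 2 ≤ (1 - 1 / (K : ℝ)) ^ 2 +
      1 / (K : ℝ) ^ 2 * ∑ i ∈ Finset.univ.erase k,
        ‖colBlock A k‖ ^ 2 * ‖pinv (colBlock A i)‖ ^ 2 := by
    intro k
    rw [← Finset.add_sum_erase _ _ (Finset.mem_univ k), Finset.mul_sum]
    exact add_le_add (hdiag k)
      (Finset.sum_le_sum fun i hi => hoff i k (Finset.ne_of_mem_erase hi))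
  refine (Finset.sum_le_sum fun k _ => hrow k).trans (le_of_eq ?_)
  rw [Finset.sum_add_distrib, ← Finset.mul_sum]
  congr 1
  simp
  field_simp

theorem norm_sq_mul_norm_pinv_sq_le_gammaBar {A : Matrix (Fin n) (Idx p) ℝ} {C : ℝ}
    {S : Matrix (Idx p) (Idx p) ℝ} {q : Fin K → ℝ} {k i : Fin K}
    (hnum : 0 < n * sigmaMax (principalBlock S k) + ell C n S q k)
    (hk : ∀ x : EuclideanSpace ℝ (Fin (p k)), ‖Matrix.toEuclideanLin (colBlock A k) x‖ ^ 2 ≤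
      (n * sigmaMax (principalBlock S k) + ell C n S q k) * ‖x‖ ^ 2)
    (hi : ∀ x : EuclideanSpace ℝ (Fin (p i)),
      (n * sigmaMin (principalBlock S i) - ell C n S q i) * ‖x‖ ^ 2 ≤
        ‖Matrix.toEuclideanLin (colBlock A i) x‖ ^ 2) :
    ENNReal.ofReal (‖colBlock A k‖ ^ 2 * ‖pinv (colBlock A i)‖ ^ 2) ≤ gammaBar C n S q k i := by
  rw [gammaBar]
  rcases le_or_gt (n * sigmaMin (principalBlock S i) - ell C n S q i) 0 with hd | hd
  -- Positivity of the numerator is essential: `0 / 0 = 0` in `ℝ≥0∞`.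
  · rw [max_eq_left hd, ENNReal.ofReal_zero, ENNReal.div_zero (by simpa using hnum)]
    exact le_top
  · rw [max_eq_right hd.le, ← ENNReal.ofReal_div_of_pos hd, div_eq_mul_one_div]
    exact ENNReal.ofReal_le_ofReal (mul_le_mul (l2_opNorm_sq_le hnum.le hk)
      (norm_pinv_sq_le hd hi) (by positivity) hnum.le)

theorem norm_iterationMatrix_le_betaBar {A : Matrix (Fin n) (Idx p) ℝ} {C : ℝ}
    {S : Matrix (Idx p) (Idx p) ℝ} {q : Fin K → ℝ} (hK : 0 < K)
    (hinj : ∀ k, pinv (colBlock A k) * colBlock A k = 1)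
    (hγ : ∀ k i, ENNReal.ofReal (‖colBlock A k‖ ^ 2 * ‖pinv (colBlock A i)‖ ^ 2) ≤
      gammaBar C n S q k i) :
    ENNReal.ofReal ‖iterationMatrix A‖ ≤ betaBar C n S q := by
  rw [betaBar, one_div (2 : ℝ), ENNReal.le_rpow_inv_iff (by norm_num),
    ENNReal.ofReal_rpow_of_nonneg (norm_nonneg _) (by norm_num), Real.rpow_two]
  refine (ENNReal.ofReal_le_ofReal (norm_iterationMatrix_sq_le hK hinj)).trans ?_
  rw [ENNReal.ofReal_add (by positivity) (by positivity), ENNReal.ofReal_mul (by positivity),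
    ENNReal.ofReal_sum_of_nonneg (fun _ _ => by positivity)]
  gcongr with k
  rw [ENNReal.ofReal_sum_of_nonneg (fun _ _ => by positivity)]
  exact Finset.sum_le_sum fun i _ => hγ k i

end Blocks

/-! ### Uniform concentration of the Gram matrix. -/

section Concentration

variable {E : Type*} [NormedAddCommGroup E] [InnerProductSpace ℝ E]

/-- The operator `∑ i, aᵢ aᵢᵀ - n T`. -/
noncomputable def gramDeviation {n : ℕ} (a : Fin n → E) (T : E →ₗ[ℝ] E) : E →ₗ[ℝ] E :=
  ∑ i, (innerₛₗ ℝ (a i)).smulRight (a i) - (n : ℝ) • T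

variable {n : ℕ}

theorem inner_gramDeviation (a : Fin n → E) (T : E →ₗ[ℝ] E) (x y : E) :
    inner ℝ (gramDeviation a T x) y =
      ∑ i, inner ℝ x (a i) * inner ℝ y (a i) - n * inner ℝ (T x) y := by
  simp only [gramDeviation, LinearMap.sub_apply, LinearMap.sum_apply, LinearMap.smulRight_apply,
    LinearMap.smul_apply, inner_sub_right, inner_sum, real_inner_smul_right, innerₛₗ_apply_apply,
    real_inner_comm x, real_inner_comm y]

theorem isSymmetric_gramDeviation (a : Fin n → E) {T : E →ₗ[ℝ] E} (hT : T.IsSymmetric) :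
    (gramDeviation a T).IsSymmetric := by
  intro x y
  rw [real_inner_comm _ x, inner_gramDeviation, inner_gramDeviation, hT x y,
    real_inner_comm _ x]
  simp only [mul_comm]

/-- With `w = s / n`, both entries of the minimum are at least `16 w`, and `n (16 w) / 8 = 2 s`. The
exponent `2 (d + q)` then absorbs the cardinality `5 ^ d ≤ e^{2d}` of the net. -/
theorem two_mul_le_min_sq_self {n s : ℝ} (hn : 0 < n) (hs : 0 ≤ s) :
    2 * s ≤ n * (min ((16 * (Real.sqrt (s / n) + s / n)) ^ 2)
      (16 * (Real.sqrt (s / n) + s / n)) / 8) := by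
  set w := s / n with hw
  have hw0 : 0 ≤ w := by positivity
  have hsn : s = n * w := by rw [hw]; field_simp
  have hsq := Real.sq_sqrt hw0
  have h0 := Real.sqrt_nonneg w
  have hmin : 16 * w ≤ min ((16 * (Real.sqrt w + w)) ^ 2) (16 * (Real.sqrt w + w)) := by
    refine le_min ?_ (by linarith)
    have : 0 ≤ Real.sqrt w * w := by positivity
    nlinarith
  rw [hsn]
  nlinarith

theorem five_pow_le_exp (d : ℕ) : (5 : ℝ) ^ d ≤ Real.exp (2 * d) := by
  rw [mul_comm, Real.exp_nat_mul]
  refine pow_le_pow_left₀ (by norm_num) ?_ d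
  have := Real.quadratic_le_exp_of_nonneg (show (0 : ℝ) ≤ 2 by norm_num)
  linarith

variable [FiniteDimensional ℝ E]
variable {Ω : Type*} [MeasurableSpace Ω] {P : Measure Ω} [IsProbabilityMeasure P]

theorem measureReal_abs_sum_inner_sq_sub_gt_le [MeasurableSpace E] [BorelSpace E]
    {b : Fin n → Ω → E} {T : E →ₗ[ℝ] E} {σ q : ℝ} (hT : T.IsSymmetric)
    (hpos : ∀ x, x ≠ 0 → 0 < inner ℝ (T x) x) (hσ : ∀ x, inner ℝ (T x) x ≤ σ * ‖x‖ ^ 2)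
    (hlaw : ∀ i c, HasLaw (fun ω => inner ℝ c (b i ω))
      (gaussianReal 0 (inner ℝ (T c) c).toNNReal) P)
    (hind : iIndepFun b P) (hn : 0 < n) (hq : 0 ≤ q) :
    P.real {ω | ∃ x : E, 32 * (n * σ) * (Real.sqrt ((Module.finrank ℝ E + q) / n) +
        (Module.finrank ℝ E + q) / n) * ‖x‖ ^ 2 <
          |∑ i, inner ℝ x (b i ω) ^ 2 - n * inner ℝ (T x) x|} ≤ 2 * Real.exp (-q) := by
  set d := Module.finrank ℝ E with hd
  have hn0 : (0 : ℝ) < n := by exact_mod_cast hn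
  obtain ⟨s, hcard, hs, hnet⟩ := exists_finset_net_sphere E
  set t : ℝ := 16 * (Real.sqrt ((d + q) / n) + (d + q) / n) with ht
  have ht0 : 0 ≤ t := by positivity
  let v : E → ℝ := fun c => inner ℝ (T c) c
  let X : E → Fin n → Ω → ℝ := fun c i ω => inner ℝ c (b i ω) / Real.sqrt (v c)
  have hv : ∀ c ∈ s, 0 < v c := fun c hc => hpos c fun h => by
    have := hs c hc
    rw [h, norm_zero] at this
    norm_num at this
  have htail : ∀ c ∈ s, P.real {ω | n * t ≤ |∑ i, (X c i ω ^ 2 - 1)|} ≤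
      2 * Real.exp (-(2 * (d + q))) := by
    intro c hc
    have hX : ∀ i, HasLaw (X c i) (gaussianReal 0 1) P := by
      intro i
      have h := gaussianReal_div_const (hlaw i c) (Real.sqrt (v c))
      convert h using 2
      · simp
      · have hvn : (v c).toNNReal ≠ 0 := by simpa using hv c hc
        rw [eq_comm, div_eq_one_iff_eq]
        · ext
          simp [Real.sq_sqrt (hv c hc).le, Real.coe_toNNReal _ (hv c hc).le, v]
        · intro h0
          have := congrArg NNReal.toReal h0
          simp [Real.sq_sqrt (hv c hc).le] at this
          exact (hv c hc).ne' this
    have hXind : iIndepFun (X c) P :=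
      hind.comp (fun _ y => inner ℝ c y / Real.sqrt (v c)) (fun _ => by fun_prop)
    refine (measureReal_abs_sum_sq_sub_one_ge_le hX hXind ht0).trans ?_
    have := two_mul_le_min_sq_self hn0 (s := d + q) (by positivity)
    gcongr
  -- The constant 32 is the 16 of `t` times the factor 2 lost on the net.
  have hsub : {ω | ∃ x : E, 32 * (n * σ) * (Real.sqrt ((d + q) / n) + (d + q) / n) * ‖x‖ ^ 2 <
      |∑ i, inner ℝ x (b i ω) ^ 2 - n * inner ℝ (T x) x|} ⊆
      ⋃ c ∈ s, {ω | n * t ≤ |∑ i, (X c i ω ^ 2 - 1)|} := by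
    rintro ω ⟨x, hx⟩
    by_contra hout
    simp only [Set.mem_iUnion, Set.mem_ofPred_eq, not_exists, not_le] at hout
    have hform : ∀ y, inner ℝ (gramDeviation (fun i => b i ω) T y) y =
        ∑ i, inner ℝ y (b i ω) ^ 2 - n * inner ℝ (T y) y := fun y => by
      simp only [inner_gramDeviation, sq]
    have hr : ∀ c ∈ s, |inner ℝ (gramDeviation (fun i => b i ω) T c) c| ≤
        n * t * σ * ‖c‖ ^ 2 := by
      intro c hc
      have hvc := hv c hc
      have e : ∑ i, inner ℝ c (b i ω) ^ 2 - n * inner ℝ (T c) c =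
          v c * ∑ i, (X c i ω ^ 2 - 1) := by
        rw [Finset.mul_sum]
        have : ∀ i, v c * (X c i ω ^ 2 - 1) = inner ℝ c (b i ω) ^ 2 - v c := fun i => by
          simp only [X]
          rw [div_pow, Real.sq_sqrt hvc.le]
          field_simp
        simp [this, v]
      rw [hform, e, abs_mul, abs_of_pos hvc]
      calc v c * |∑ i, (X c i ω ^ 2 - 1)| ≤ v c * (n * t) :=
            mul_le_mul_of_nonneg_left (hout c hc).le hvc.le
        _ ≤ (σ * ‖c‖ ^ 2) * (n * t) := mul_le_mul_of_nonneg_right (hσ c) (by positivity)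
        _ = _ := by ring
    have := abs_inner_apply_self_le_of_net (isSymmetric_gramDeviation _ hT) hs hnet hr x
    rw [hform] at this
    refine absurd hx (not_lt.mpr (this.trans (le_of_eq ?_)))
    rw [ht]; ring
  calc _ ≤ P.real (⋃ c ∈ s, {ω | n * t ≤ |∑ i, (X c i ω ^ 2 - 1)|}) :=
        measureReal_mono hsub (measure_ne_top _ _)
    _ ≤ ∑ c ∈ s, P.real {ω | n * t ≤ |∑ i, (X c i ω ^ 2 - 1)|} :=
        measureReal_biUnion_finset_le _ _
    _ ≤ ∑ _c ∈ s, 2 * Real.exp (-(2 * (d + q))) := Finset.sum_le_sum htail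
    _ = s.card * (2 * Real.exp (-(2 * (d + q)))) := by simp
    _ ≤ Real.exp (2 * d) * (2 * Real.exp (-(2 * (d + q)))) := by
        gcongr
        exact le_trans (by exact_mod_cast hcard) (five_pow_le_exp d)
    _ = 2 * Real.exp (-(2 * q)) := by
        rw [mul_left_comm, ← Real.exp_add]; ring_nf
    _ ≤ _ := by gcongr; linarith

end Concentration

/-! ### Gaussian laws of the column blocks. -/

section GaussianBlocks

variable {K : ℕ} {p : Fin K → ℕ} {S : Matrix (Idx p) (Idx p) ℝ}
variable {Ω : Type*} [MeasurableSpace Ω] {P : Measure Ω}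

theorem measurable_vecBlock (k : Fin K) : Measurable (vecBlock (p := p) k) := by
  unfold vecBlock
  fun_prop

/-- Pairing a block with `c` is pairing the whole vector with the extension `c'` of `c` by zero,
whose variance only involves `Σ_k`. -/
theorem hasLaw_inner_vecBlock (hS : S.PosSemidef) {a : Ω → EuclideanSpace ℝ (Idx p)}
    (ha : HasLaw a (multivariateGaussian 0 S) P) (k : Fin K) (c : EuclideanSpace ℝ (Fin (p k))) :
    HasLaw (fun ω => inner ℝ c (vecBlock k (a ω)))
      (gaussianReal 0 (inner ℝ (Matrix.toEuclideanLin (principalBlock S k) c) c).toNNReal) P := by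
  let e : Fin (p k) → EuclideanSpace ℝ (Idx p) := fun l => EuclideanSpace.single ⟨k, l⟩ 1
  let c' : EuclideanSpace ℝ (Idx p) := ∑ l, c l • e l
  have hc' : ∀ y, inner ℝ c' y = inner ℝ c (vecBlock k y) := fun y => by
    simp [c', e, sum_inner, vecBlock, PiLp.inner_apply, mul_comm]
  have hvar : Var[innerSL ℝ c'; multivariateGaussian 0 S] =
      inner ℝ (Matrix.toEuclideanLin (principalBlock S k) c) c := by
    have h := covarianceBilin_self (μ := multivariateGaussian 0 S) IsGaussian.memLp_two_id c'
    have he : ∀ l m, covarianceBilin (multivariateGaussian 0 S) (e l) (e m) =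
        S ⟨k, l⟩ ⟨k, m⟩ := fun l m => by
      rw [covarianceBilin_multivariateGaussian hS]
      simp [e]
    have h2 : covarianceBilin (multivariateGaussian 0 S) c' c' =
        inner ℝ (Matrix.toEuclideanLin (principalBlock S k) c) c := by
      simp only [c', map_sum, map_smul, _root_.sum_apply,
        _root_.smul_apply, he, smul_eq_mul]
      simp only [PiLp.inner_apply, Matrix.toLpLin_apply, Matrix.mulVec, dotProduct,
        principalBlock, Matrix.submatrix_apply]
      simp only [Finset.mul_sum, RCLike.inner_apply, conj_trivial]
      rw [Finset.sum_comm]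
      exact Finset.sum_congr rfl fun _ _ => Finset.sum_congr rfl fun _ _ => by ring
    rw [← h2, h]
    rfl
  have hmap := IsGaussian.map_eq_gaussianReal (μ := multivariateGaussian 0 S) (innerSL ℝ c')
  have hmean : (multivariateGaussian 0 S)[innerSL ℝ c'] = 0 := by
    rw [ContinuousLinearMap.integral_comp_id_comm IsGaussian.integrable_id]
    simp
  rw [hvar, hmean] at hmap
  have hl : HasLaw (innerSL ℝ c') _ (multivariateGaussian 0 S) := ⟨by fun_prop, hmap⟩
  have := hl.comp ha
  convert this using 1
  ext ω
  exact (hc' _).symm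

theorem posDef_principalBlock (hS : S.PosDef) (k : Fin K) : (principalBlock S k).PosDef :=
  hS.submatrix (e := Sigma.mk k) sigma_mk_injective

theorem inner_toEuclideanLin_pos {d : ℕ} {M : Matrix (Fin d) (Fin d) ℝ} (hM : M.PosDef)
    {x : EuclideanSpace ℝ (Fin d)} (hx : x ≠ 0) : 0 < inner ℝ (Matrix.toEuclideanLin M x) x := by
  have h := hM.dotProduct_mulVec_pos (x := x.ofLp) (by simpa using hx)
  simpa [PiLp.inner_apply, Matrix.toLpLin_apply, dotProduct] using h

theorem map_vecBlock_hyperplane_eq_zero (hS : S.PosDef) (k : Fin K)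
    {v : EuclideanSpace ℝ (Fin (p k))} (hv : v ≠ 0) :
    (multivariateGaussian 0 S).map (vecBlock k) {y | inner ℝ v y = 0} = 0 := by
  have hm : MeasurableSet {y : EuclideanSpace ℝ (Fin (p k)) | inner ℝ v y = 0} :=
    (measurableSet_singleton (0 : ℝ)).preimage (by fun_prop)
  rw [Measure.map_apply (measurable_vecBlock k) hm]
  have h := hasLaw_inner_vecBlock hS.posSemidef (HasLaw.id (μ := multivariateGaussian 0 S)) k v
  have hpos := inner_toEuclideanLin_pos (posDef_principalBlock hS k) hv
  have := nullSingletonClass_gaussianReal (μ := 0)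
    (v := (inner ℝ (Matrix.toEuclideanLin (principalBlock S k) v) v).toNNReal) (by simpa using hpos)
  have h0 : gaussianReal 0 (inner ℝ (Matrix.toEuclideanLin (principalBlock S k) v) v).toNNReal
    {(0 : ℝ)} = 0 := measure_singleton _
  rw [← h.map_eq, Measure.map_apply_of_aemeasurable h.aemeasurable (measurableSet_singleton _)]
    at h0
  exact h0

variable {n : ℕ}

theorem toEuclideanLin_colBlock_apply (a : Fin n → EuclideanSpace ℝ (Idx p)) (k : Fin K)
    (x : EuclideanSpace ℝ (Fin (p k))) (i : Fin n) :
    Matrix.toEuclideanLin (colBlock (regressorMatrix a) k) x i = inner ℝ x (vecBlock k (a i)) := by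
  simp [Matrix.toLpLin_apply, Matrix.mulVec, dotProduct, colBlock, regressorMatrix, vecBlock,
    PiLp.inner_apply]

theorem norm_toEuclideanLin_colBlock_sq (a : Fin n → EuclideanSpace ℝ (Idx p)) (k : Fin K)
    (x : EuclideanSpace ℝ (Fin (p k))) :
    ‖Matrix.toEuclideanLin (colBlock (regressorMatrix a) k) x‖ ^ 2 =
      ∑ i, inner ℝ x (vecBlock k (a i)) ^ 2 := by
  simp only [EuclideanSpace.real_norm_sq_eq, toEuclideanLin_colBlock_apply]

variable [IsProbabilityMeasure P] {a : Fin n → Ω → EuclideanSpace ℝ (Idx p)}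

omit [IsProbabilityMeasure P] in
-- This cannot be dispensed with when `K = 1`: there `β̄ = 0`, so `B` must vanish exactly.
theorem ae_pinv_colBlock_mul_self_eq_one (hS : S.PosDef)
    (ha : ∀ i, HasLaw (a i) (multivariateGaussian 0 S) P) (hind : iIndepFun a P)
    {k : Fin K} (hk : p k ≤ n) :
    ∀ᵐ ω ∂P, pinv (colBlock (regressorMatrix fun i => a i ω) k) *
      colBlock (regressorMatrix fun i => a i ω) k = 1 := by
  have hm := measurable_vecBlock (p := p) k
  have : IsProbabilityMeasure ((multivariateGaussian 0 S).map (vecBlock k)) :=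
    Measure.isProbabilityMeasure_map hm.aemeasurable
  have hlaw : ∀ i, HasLaw (fun ω => vecBlock k (a i ω))
      ((multivariateGaussian 0 S).map (vecBlock k)) P := fun i =>
    HasLaw.comp (Y := vecBlock k) ⟨hm.aemeasurable, rfl⟩ (ha i)
  have hind' : iIndepFun (fun i ω => vecBlock k (a i ω)) P :=
    hind.comp (fun _ => vecBlock k) fun _ => hm
  filter_upwards [ae_forall_inner_eq_zero_imp
    (fun v hv => map_vecBlock_hyperplane_eq_zero hS k hv) hlaw hind' (by simpa using hk)] with ω hω
  refine pinv_mul_self_eq_one fun x hx => hω x fun i => ?_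
  rw [real_inner_comm, ← toEuclideanLin_colBlock_apply (fun i => a i ω), hx]
  rfl

theorem measureReal_exists_abs_norm_colBlock_sq_sub_gt_le (hS : S.PosDef)
    (ha : ∀ i, HasLaw (a i) (multivariateGaussian 0 S) P) (hind : iIndepFun a P) (hn : 0 < n)
    (k : Fin K) {q : Fin K → ℝ} (hq : 0 ≤ q k) :
    P.real {ω | ∃ x, ell 12 n S q k * ‖x‖ ^ 2 <
      |‖Matrix.toEuclideanLin (colBlock (regressorMatrix fun i => a i ω) k) x‖ ^ 2 -
        n * inner ℝ (Matrix.toEuclideanLin (principalBlock S k) x) x|} ≤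
      2 * Real.exp (-q k) := by
  have hind' : iIndepFun (fun i ω => vecBlock k (a i ω)) P :=
    hind.comp (fun _ => vecBlock k) fun _ => measurable_vecBlock k
  have hMk := posDef_principalBlock hS k
  have h := measureReal_abs_sum_inner_sq_sub_gt_le
    (Matrix.isPositive_toEuclideanLin_iff.mpr hMk.posSemidef).isSymmetric
    (fun x hx => inner_toEuclideanLin_pos hMk hx) inner_toEuclideanLin_le_sigmaMax
    (fun i c => hasLaw_inner_vecBlock hS.posSemidef (ha i) k c) hind' hn hq
  refine le_trans (le_of_eq ?_) h
  congr 1 with ω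
  simp only [Set.mem_ofPred_eq, norm_toEuclideanLin_colBlock_sq, finrank_euclideanSpace_fin, ell]
  ring_nf

end GaussianBlocks

end Cocoa

/-! ### Assembly by a union bound. -/

theorem lemma5 :
    ∃ C : ℝ, 0 < C ∧
      ∀ (n K : ℕ) (_ : 0 < K) (p : Fin K → ℕ) (_ : ∀ k, 0 < p k) (_ : ∀ k, p k ≤ n)
        (S : Matrix (Cocoa.Idx p) (Cocoa.Idx p) ℝ) (_ : S.PosDef)
        (q : Fin K → ℝ) (_ : ∀ k, 0 ≤ q k)
        (Ω : Type*) [MeasurableSpace Ω] (P : Measure Ω) [IsProbabilityMeasure P]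
        (a : Fin n → Ω → EuclideanSpace ℝ (Cocoa.Idx p))
        (_ : ∀ i, HasLaw (a i) (multivariateGaussian 0 S) P)
        (_ : iIndepFun a P),
        1 - 2 * ∑ k, Real.exp (-q k) ≤
          P.real {ω | ENNReal.ofReal
              ‖Cocoa.iterationMatrix (Cocoa.regressorMatrix fun i => a i ω)‖ ≤
            Cocoa.betaBar C n S q} := by
  -- Chosen so that `(8/3) · 12 = 32`, the constant of the concentration bound.
  refine ⟨12, by norm_num, ?_⟩
  intro n K hK p hp hpn S hS q hq Ω _ P _ a ha hind
  have hn : 0 < n := (hp ⟨0, hK⟩).trans_le (hpn ⟨0, hK⟩)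
  set good := {ω | ENNReal.ofReal
    ‖Cocoa.iterationMatrix (Cocoa.regressorMatrix fun i => a i ω)‖ ≤ Cocoa.betaBar 12 n S q}
  let A : Ω → Matrix (Fin n) (Cocoa.Idx p) ℝ := fun ω => Cocoa.regressorMatrix fun i => a i ω
  let bad : Fin K → Set Ω := fun k => {ω | ∃ x, Cocoa.ell 12 n S q k * ‖x‖ ^ 2 <
    |‖Matrix.toEuclideanLin (Cocoa.colBlock (A ω) k) x‖ ^ 2 -
      n * inner ℝ (Matrix.toEuclideanLin (Cocoa.principalBlock S k) x) x|}
  let deficient : Set Ω := {ω | ¬ ∀ k, Cocoa.pinv (Cocoa.colBlock (A ω) k) *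
    Cocoa.colBlock (A ω) k = 1}
  have hdef : P.real deficient = 0 := by
    have : ∀ᵐ ω ∂P, ∀ k, Cocoa.pinv (Cocoa.colBlock (A ω) k) * Cocoa.colBlock (A ω) k = 1 :=
      ae_all_iff.mpr fun k => Cocoa.ae_pinv_colBlock_mul_self_eq_one hS ha hind (hpn k)
    rw [measureReal_def, show P deficient = 0 from this, ENNReal.toReal_zero]
  -- Covering the whole space and using subadditivity avoids complements, so no event has to be
  -- shown measurable.
  have hcover : (Set.univ : Set Ω) ⊆ good ∪ ((⋃ k, bad k) ∪ deficient) := by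
    intro ω _
    by_contra hω
    simp only [Set.mem_union, not_or, Set.mem_iUnion, not_exists] at hω
    obtain ⟨hgood, hbad, hinj⟩ := hω
    refine hgood (Cocoa.norm_iterationMatrix_le_betaBar hK (not_not.mp hinj) fun k i => ?_)
    have hdev : ∀ k x, |‖Matrix.toEuclideanLin (Cocoa.colBlock (A ω) k) x‖ ^ 2 -
        n * inner ℝ (Matrix.toEuclideanLin (Cocoa.principalBlock S k) x) x| ≤
          Cocoa.ell 12 n S q k * ‖x‖ ^ 2 :=
      fun k x => not_lt.mp fun h => hbad k ⟨x, h⟩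
    have hσ := Cocoa.sigmaMax_pos (Cocoa.posDef_principalBlock hS k) (hp k)
    have hqk := hq k
    have hn0 : (0 : ℝ) < n := by exact_mod_cast hn
    refine Cocoa.norm_sq_mul_norm_pinv_sq_le_gammaBar ?_ (fun x => ?_) fun x => ?_
    · have : 0 ≤ Cocoa.ell 12 n S q k := by
        unfold Cocoa.ell
        positivity
      positivity
    · have h1 := (abs_le.mp (hdev k x)).2
      have h2 := mul_le_mul_of_nonneg_left
        (Cocoa.inner_toEuclideanLin_le_sigmaMax (M := Cocoa.principalBlock S k) x) hn0.le
      linarith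
    · have h1 := (abs_le.mp (hdev i x)).1
      have h2 := mul_le_mul_of_nonneg_left (Cocoa.sigmaMin_mul_le_inner_toEuclideanLin
        (Cocoa.posDef_principalBlock hS i).posSemidef x) hn0.le
      linarith
  have hbad : P.real (⋃ k, bad k) ≤ 2 * ∑ k, Real.exp (-q k) := by
    rw [Finset.mul_sum]
    exact (measureReal_iUnion_fintype_le _).trans (Finset.sum_le_sum fun k _ =>
      Cocoa.measureReal_exists_abs_norm_colBlock_sq_sub_gt_le hS ha hind hn k (hq k))
  have h1 : (1 : ℝ) ≤ P.real (good ∪ ((⋃ k, bad k) ∪ deficient)) := by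
    rw [← probReal_univ (μ := P)]
    exact measureReal_mono hcover
  have h2 := measureReal_union_le (μ := P) good ((⋃ k, bad k) ∪ deficient)
  have h3 := measureReal_union_le (μ := P) (⋃ k, bad k) deficient
  linarith
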